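/- Sets of natural numbers are represented in $\omega^\omega$ by their characteristic functions, and for $f,g\in\omega^\omega$ let $\langle f,g\rangle(2n)=f(n)$ and $\langle f,g\rangle(2n+1)=g(n)$. A problem $\mathcal F$ is a multi-valued partial function $\mathcal F\colon\subseteq\omega^\omega\rightrightarrows\omega^\omega$; the elements of $\operatorname{dom}(\mathcal F)$ are its instances and the elements of $\mathcal F(f)$ are the solutions to the instance $f$. A Turing functional $\Phi\colon\subseteq\omega^\omega\to\omega^\omega$ is given by an oracle program: $\Phi(f)$ is the function computed by the program with oracle $f$, and it is defined if the program halts on every input. For problems $\mathcal F,\mathcal G$, we write $\mathcal F\leq_{\mathrm W}\mathcal G$ ($\mathcal F$ Weihrauch reduces to $\mathcal G$) if there are Turing functionals $\Phi,\Psi$ such that $\Phi(f)$ is defined and in $\operatorname{dom}(\mathcal G)$ for all $f\in\operatorname{dom}(\mathcal F)$, and $\Psi(\langle f,g\rangle)$ is defined and in $\mathcal F(f)$ for all $f\in\operatorname{dom}(\mathcal F)$ and $g\in\mathcal G(\Phi(f))$. $\mathsf{SADC}$ (the stable ascending/descending chain principle) is the following problem. An instance is a linear order $(L,<_L)$ of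 order type $\omega+\omega^*$ with $L\subseteq\omega$. A solution is an infinite set $C\subseteq L$ that is an ascending chain ($\{x\in C: x<_L y\}$ is finite for every $y\in C$) or a descending chain ($\{x\in C: y<_L x\}$ is finite for every $y\in C$). $\mathsf{wRSgr}$ (the refined weak Rival--Sands theorem for graphs) is the following problem. An instance is an infinite simple graph $G=(V,E)$ with $V\subseteq\omega$. A solution is an infinite set $H\subseteq V$ such that every $v\in H$ has either infinitely many neighbors in $H$ or no neighbor in $H$. Here a linear order is represented by the pairing of the characteristic functions of $L$ and of (the set of codes of pairs in) $<_L$, and a graph by the pairing of the characteristic functions of $V$ and of (the set of codes of pairs $(x,y)$ with $x<y$ in) $E$. Theorem. $\mathsf{SADC}\not\leq_{\mathrm W}\mathsf{wRSgr}$. -/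

import Mathlib

namespace RivalSands

/-- Programs for oracle computations: the usual schemes for the partial recursive functions
together with a query to the oracle. A program mentions no particular oracle. -/
inductive OracleCode : Type
  | zero : OracleCode
  | succ : OracleCode
  | left : OracleCode
  | right : OracleCode
  | oracle : OracleCode
  | pair : OracleCode → OracleCode → OracleCode
  | comp : OracleCode → OracleCode → OracleCode
  | prec : OracleCode → OracleCode → OracleCode
  | rfind : OracleCode → OracleCode

/-- The partial function `ℕ →. ℕ` computed by a program when its oracle queries are answered
by `g`. The clauses are those of Mathlib's `Nat.RecursiveIn`. (Turing functionals below only use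
total oracles.) -/
def OracleCode.eval (g : ℕ →. ℕ) : OracleCode → ℕ →. ℕ
  | .zero => fun _ => Part.some 0
  | .succ => fun n => Part.some (Nat.succ n)
  | .left => fun n => Part.some (Nat.unpair n).1
  | .right => fun n => Part.some (Nat.unpair n).2
  | .oracle => g
  | .pair c d => fun n => Nat.pair <$> c.eval g n <*> d.eval g n
  | .comp c d => fun n => d.eval g n >>= c.eval g
  | .prec c d => fun p =>
      let (a, n) := Nat.unpair p
      n.rec (c.eval g a) fun y IH => do
        let i ← IH
        d.eval g (Nat.pair a (Nat.pair y i))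
  | .rfind c => fun a => Nat.rfind fun n => (fun m => m = 0) <$> c.eval g (Nat.pair a n)

/-- For each fixed oracle, the functions computed by programs are exactly those that are
recursive in the oracle in Mathlib's sense. -/
theorem OracleCode.exists_eval_eq_iff {g f : ℕ →. ℕ} :
    (∃ c : OracleCode, c.eval g = f) ↔ Nat.RecursiveIn {g} f := by
  constructor
  · rintro ⟨c, rfl⟩
    induction c with
    | zero => exact .zero
    | succ => exact .succ
    | left => exact .left
    | right => exact .right
    | oracle => exact .oracle g rfl
    | pair c d hc hd => exact .pair hc hd
    | comp c d hc hd => exact .comp hc hd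
    | prec c d hc hd => exact .prec hc hd
    | rfind c hc => exact .rfind hc
  · intro h
    induction h with
    | zero => exact ⟨.zero, rfl⟩
    | succ => exact ⟨.succ, rfl⟩
    | left => exact ⟨.left, rfl⟩
    | right => exact ⟨.right, rfl⟩
    | oracle g' hg => exact ⟨.oracle, (Set.mem_singleton_iff.mp hg).symm⟩
    | pair _ _ hc hd =>
      obtain ⟨c, rfl⟩ := hc
      obtain ⟨d, rfl⟩ := hd
      exact ⟨.pair c d, rfl⟩
    | comp _ _ hc hd =>
      obtain ⟨c, rfl⟩ := hc
      obtain ⟨d, rfl⟩ := hd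
      exact ⟨.comp c d, rfl⟩
    | prec _ _ hc hd =>
      obtain ⟨c, rfl⟩ := hc
      obtain ⟨d, rfl⟩ := hd
      exact ⟨.prec c d, rfl⟩
    | rfind _ hc =>
      obtain ⟨c, rfl⟩ := hc
      exact ⟨.rfind c, rfl⟩

/-- The partial function from Baire space to Baire space given by a program: it is defined at `f`
if the program with oracle `f` halts on every input, and its value is then the function
computed. -/
def OracleCode.functional (c : OracleCode) : (ℕ → ℕ) →. (ℕ → ℕ) := fun f =>
  ⟨∀ n, (c.eval (f : ℕ →. ℕ) n).Dom, fun h n => (c.eval (f : ℕ →. ℕ) n).get (h n)⟩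

/-- Turing functionals. -/
def IsTuringFunctional (Φ : (ℕ → ℕ) →. (ℕ → ℕ)) : Prop :=
  ∃ c : OracleCode, Φ = c.functional

/-- The pairing of `f` and `g`, with `f` on the even and `g` on the odd numbers. -/
def join (f g : ℕ → ℕ) : ℕ → ℕ := fun n => if n % 2 = 0 then f (n / 2) else g (n / 2)

/-- A multi-valued partial function on Baire space, given by its domain (the instances) and by
the set of values (the solutions) at each instance. -/
structure MultiFun where
  /-- The set of instances. -/
  dom : Set (ℕ → ℕ)
  /-- The solutions to an instance; only the values on `dom` matter. -/
  sol : (ℕ → ℕ) → Set (ℕ → ℕ)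

/-- Weihrauch reducibility of multi-valued functions on Baire space. -/
def WeihrauchReducible (F G : MultiFun) : Prop :=
  ∃ Φ Ψ : (ℕ → ℕ) →. (ℕ → ℕ), IsTuringFunctional Φ ∧ IsTuringFunctional Ψ ∧
    ∀ f ∈ F.dom, ∃ h ∈ Φ f, h ∈ G.dom ∧
      ∀ g ∈ G.sol h, ∃ k ∈ Ψ (join f g), k ∈ F.sol f

/-- The characteristic function of a set of natural numbers, which represents the set in Baire
space. -/
noncomputable def charFn (A : Set ℕ) : ℕ → ℕ := A.indicator 1

/-- A linear order whose domain is a set of natural numbers. -/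
structure LinOrd where
  /-- The domain. -/
  carrier : Set ℕ
  /-- The strict order relation. -/
  lt : carrier → carrier → Prop
  /-- The relation is a strict linear order. -/
  isStrictTotalOrder : IsStrictTotalOrder carrier lt

/-- The point of Baire space that represents a linear order: the pairing of the characteristic
functions of the domain and of the set of pairs in the strict order. -/
noncomputable def LinOrd.code (L : LinOrd) : ℕ → ℕ :=
  join (charFn L.carrier)
    (charFn {n | ∃ x y : L.carrier, L.lt x y ∧ n = Nat.pair (x : ℕ) (y : ℕ)})

/-- The linear order has order type `ω + ω*`. -/
def LinOrd.HasTypeOmegaAddOmegaStar (L : LinOrd) : Prop :=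
  Nonempty (L.lt ≃r ((· < ·) : ℕ ⊕ₗ ℕᵒᵈ → ℕ ⊕ₗ ℕᵒᵈ → Prop))

/-- `C` is an ascending chain in `L`. -/
def LinOrd.IsAscendingChain (L : LinOrd) (C : Set L.carrier) : Prop :=
  ∀ y ∈ C, {x ∈ C | L.lt x y}.Finite

/-- `C` is a descending chain in `L`. -/
def LinOrd.IsDescendingChain (L : LinOrd) (C : Set L.carrier) : Prop :=
  ∀ y ∈ C, {x ∈ C | L.lt y x}.Finite

/-- The stable ascending/descending chain principle. Instances are the linear orders of type
`ω + ω*` with domain a set of natural numbers; solutions are the infinite subsets that are an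
ascending or a descending chain. -/
def SADC : MultiFun where
  dom := {f | ∃ L : LinOrd, L.HasTypeOmegaAddOmegaStar ∧ f = L.code}
  sol f := {g | ∃ L : LinOrd, f = L.code ∧ ∃ C : Set L.carrier, C.Infinite ∧
    (L.IsAscendingChain C ∨ L.IsDescendingChain C) ∧ g = charFn (Subtype.val '' C)}

/-- Simple graphs whose vertex set is a set of natural numbers, as subgraphs of the complete graph
on `ℕ`. -/
abbrev NatGraph : Type := (⊤ : SimpleGraph ℕ).Subgraph

/-- The point of Baire space that represents a graph: the pairing of the characteristic
functions of the vertex set and of the set of edges, each edge `{x, y}` with `x < y` being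
listed as the pair `(x, y)`. -/
noncomputable def NatGraph.code (G : NatGraph) : ℕ → ℕ :=
  join (charFn G.verts) (charFn {n | ∃ x y : ℕ, x < y ∧ G.Adj x y ∧ n = Nat.pair x y})

/-- The refined weak Rival–Sands theorem for graphs. Instances are the infinite graphs; solutions
are the infinite sets `H` of vertices such that every member of `H` has either infinitely many
neighbors in `H` or none. -/
def wRSgr : MultiFun where
  dom := {f | ∃ G : NatGraph, G.verts.Infinite ∧ f = NatGraph.code G}
  sol f := {g | ∃ G : NatGraph, f = NatGraph.code G ∧ ∃ H : Set ℕ, H ⊆ G.verts ∧ H.Infinite ∧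
    (∀ v ∈ H, (H ∩ G.neighborSet v).Infinite ∨ H ∩ G.neighborSet v = ∅) ∧ g = charFn H}

end RivalSands

/-! Only the continuity of Turing functionals matters. A reduction would yield a continuous map `G`
from sets `X` of rationals of order type `ω + ω*` to infinite graphs, and a continuous way to read
an infinite chain in `X` off a solution for `G X`.

Finite information about `X` leaves the cut between `ω` and `ω*` free within an interval. A chain
read off a solution `H` contains two elements `y < z` that are still in this interval. They are
enumerated from an initial segment of `H` and finite information about `X`. Forcing all later
elements of `X` between `y` and `z` puts `y` into the `ω` part and `z` into the `ω*` part, and no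
infinite chain contains both. Hence no solution extends that initial segment (`exists_refines`).

If infinite independent sets occur below every condition, a generic `X` has arbitrarily late finite
independent sets that begin no solution. Then no nonempty vertex set has infinite degree at all of
its vertices (`exists_isSolution_of_isInfDegree`), so almost all vertices are adjacent to each of
these finite sets (`exists_isSolution_of_infinite`). By Zorn's lemma this yields such a vertex set
after all (`exists_isInfDegree`).

If they are absent below some condition, almost all tails of the vertex set are solutions, and a
generic `X` rules out arbitrarily late tails. -/

namespace RivalSands
open Filter Set

/-! ### Continuity of Turing functionals -/

/-- The use principle: a converging oracle computation looks only at finitely many values of the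
oracle. -/
theorem OracleCode.eventually_mem_eval (c : OracleCode) (g : ℕ → ℕ) :
    ∀ n v : ℕ, v ∈ c.eval (g : ℕ →. ℕ) n →
      ∀ᶠ K in atTop, ∀ g' : ℕ → ℕ, (∀ i < K, g' i = g i) → v ∈ c.eval (g' : ℕ →. ℕ) n := by
  induction c with
  | zero => exact fun n v h => .of_forall fun _ _ _ => h
  | succ => exact fun n v h => .of_forall fun _ _ _ => h
  | left => exact fun n v h => .of_forall fun _ _ _ => h
  | right => exact fun n v h => .of_forall fun _ _ _ => h
  | oracle =>
    intro n v h
    filter_upwards [eventually_gt_atTop n] with K hK g' hg'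
    have h' : v = g n := by simpa [OracleCode.eval] using h
    simp [OracleCode.eval, hg' n hK, h']
  | pair c d hc hd =>
    intro n v h
    simp only [OracleCode.eval, Seq.seq, Part.map_eq_map, Part.mem_bind_iff, Part.mem_map_iff] at h ⊢
    obtain ⟨_, ⟨x, hx, rfl⟩, y, hy, rfl⟩ := h
    filter_upwards [hc n x hx, hd n y hy] with K h1 h2 g' hg'
    exact ⟨_, ⟨x, h1 g' hg', rfl⟩, y, h2 g' hg', rfl⟩
  | comp c d hc hd =>
    intro n v h
    obtain ⟨x, hx, hv⟩ := Part.mem_bind_iff.1 h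
    filter_upwards [hd n x hx, hc x v hv] with K h1 h2 g' hg'
    exact Part.mem_bind_iff.2 ⟨x, h1 g' hg', h2 g' hg'⟩
  | prec c d hc hd =>
    intro n
    simp only [OracleCode.eval]
    generalize (Nat.unpair n).1 = a
    generalize (Nat.unpair n).2 = m
    induction m with
    | zero => exact fun v h => hc a v h
    | succ m ih =>
      intro v h
      simp only [Part.bind_eq_bind, Part.mem_bind_iff] at h ⊢
      obtain ⟨x, hx, hv⟩ := h
      filter_upwards [ih x hx, hd _ v hv] with K h1 h2 g' hg'
      exact ⟨x, h1 g' hg', h2 g' hg'⟩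
  | rfind c hc =>
    intro n v h
    obtain ⟨h0, hlt⟩ := Nat.mem_rfind.1 h
    obtain ⟨x, hx, hx0⟩ := (Part.mem_map_iff _).1 h0
    replace hlt := fun m (hm : m < v) => (Part.mem_map_iff _).1 (hlt hm)
    choose! y hy hy0 using hlt
    -- An unbounded search that stops at `v` has run only finitely many computations.
    have hall := (eventually_all_finite (finite_Iio v)).2 fun m hm => hc _ _ (hy m hm)
    filter_upwards [hc _ _ hx, hall] with K h1 h2 g' hg'
    exact Nat.mem_rfind.2 ⟨(Part.mem_map_iff _).2 ⟨x, h1 g' hg', hx0⟩, fun {m} hm =>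
      (Part.mem_map_iff _).2 ⟨y m, h2 m hm g' hg', hy0 m hm⟩⟩

theorem OracleCode.mem_functional {c : OracleCode} {f h : ℕ → ℕ} :
    h ∈ c.functional f ↔ ∀ n, h n ∈ c.eval (f : ℕ →. ℕ) n := by
  constructor
  · rintro ⟨hd, rfl⟩ n
    exact Part.get_mem (hd n)
  · intro H
    exact ⟨fun n => (H n).1, funext fun n => (H n).2⟩

/-- Turing functionals are continuous. -/
theorem OracleCode.exists_use {c : OracleCode} {f h : ℕ → ℕ} (hh : h ∈ c.functional f) (n : ℕ) :
    ∃ K, ∀ f' : ℕ → ℕ, (∀ i < K, f' i = f i) → ∀ h' ∈ c.functional f', ∀ i < n, h' i = h i := by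
  have hall := (eventually_all_finite (finite_Iio n)).2 fun m _ =>
    c.eventually_mem_eval f m (h m) (mem_functional.1 hh m)
  obtain ⟨K, hK⟩ := hall.exists
  exact ⟨K, fun f' hf' h' hh' i hi =>
    Part.mem_unique (mem_functional.1 hh' i) (hK i hi f' hf')⟩

/-! ### Extending finite independent sets to solutions in a fixed graph -/

namespace NatGraph

/-- Solutions to the refined weak Rival–Sands theorem. -/
def IsSolution (G : NatGraph) (H : Set ℕ) : Prop :=
  H ⊆ G.verts ∧ H.Infinite ∧ ∀ v ∈ H, (H ∩ G.neighborSet v).Infinite ∨ H ∩ G.neighborSet v = ∅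

/-- A set of pairwise non-adjacent vertices. -/
def IsIndep (G : NatGraph) (E : Set ℕ) : Prop :=
  E ⊆ G.verts ∧ ∀ u ∈ E, ∀ v ∈ E, ¬ G.Adj u v

/-- A set of vertices, each of which has infinitely many neighbors in the set. -/
def IsInfDegree (G : NatGraph) (Z : Set ℕ) : Prop :=
  Z ⊆ G.verts ∧ ∀ v ∈ Z, (Z ∩ G.neighborSet v).Infinite

variable {G : NatGraph} {E H Z Y : Set ℕ} {K : ℕ}

theorem IsIndep.mono (h : G.IsIndep E) (hH : H ⊆ E) : G.IsIndep H :=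
  ⟨hH.trans h.1, fun u hu v hv => h.2 u (hH hu) v (hH hv)⟩

theorem IsIndep.isSolution (h : G.IsIndep H) (hi : H.Infinite) : G.IsSolution H :=
  ⟨h.1, hi, fun v hv => .inr (eq_empty_of_forall_notMem fun u hu => h.2 v hv u hu.1 hu.2)⟩

theorem inter_Ici_infinite {A : Set ℕ} (hA : A.Infinite) (k : ℕ) : (A ∩ Ici k).Infinite := by
  have : A ∩ Ici k = A \ Iio k := by ext; simp
  rw [this]
  exact hA.sdiff (finite_Iio k)

theorem IsInfDegree.infinite (h : G.IsInfDegree Z) (hne : Z.Nonempty) : Z.Infinite :=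
  let ⟨v, hv⟩ := hne
  (h.2 v hv).mono inter_subset_left

/-- If some nonempty set has infinite degree at all of its vertices, then each finite independent
set is an initial segment of a solution. -/
theorem IsIndep.exists_isSolution_of_isInfDegree (hE : G.IsIndep E) (hEK : E ⊆ Iio K)
    (hZ : G.IsInfDegree Z) (hne : Z.Nonempty) :
    ∃ H, G.IsSolution H ∧ H ∩ Iio K = E := by
  have hEfin : E.Finite := (finite_Iio K).subset hEK
  set S : Set ℕ := ⋃₀ {Z | G.IsInfDegree Z} with hS
  have hSinf : G.IsInfDegree S := by
    refine ⟨sUnion_subset fun Z hZ => hZ.1, fun v ⟨Z, hZ, hv⟩ => (hZ.2 v hv).mono ?_⟩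
    exact inter_subset_inter_left _ (subset_sUnion_of_mem hZ)
  have hSi : S.Infinite := (hZ.infinite hne).mono (subset_sUnion_of_mem hZ)
  -- `S` is the largest set of infinite degree: a vertex with infinitely many neighbors in `S` could
  -- be added to it.
  have hmem : ∀ v ∈ E, v ∉ S → (S ∩ G.neighborSet v).Finite := by
    intro v hv hvS
    by_contra hinf
    refine hvS (mem_sUnion.2 ⟨insert v S, ⟨insert_subset (hE.1 hv) hSinf.1, ?_⟩, mem_insert _ _⟩)
    have hsub : ∀ w, S ∩ G.neighborSet w ⊆ insert v S ∩ G.neighborSet w := fun w =>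
      inter_subset_inter_left _ (subset_insert _ _)
    rintro w (rfl | hw)
    · exact Set.Infinite.mono (hsub _) hinf
    · exact (hSinf.2 w hw).mono (hsub _)
  have hev : ∀ᶠ k in atTop, ∀ v ∈ E, v ∉ S → S ∩ G.neighborSet v ⊆ Iio k := by
    refine (eventually_all_finite hEfin).2 fun v hv => ?_
    by_cases hvS : v ∈ S
    · exact .of_forall fun _ h => (h hvS).elim
    · obtain ⟨b, hb⟩ := (hmem v hv hvS).bddAbove
      filter_upwards [eventually_gt_atTop b] with k hk _ u hu
      exact (hb hu).trans_lt hk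
  -- Cutting `S` off at `k` isolates the vertices of `E` outside `S` and changes nothing below `K`;
  -- vertices in `S` keep infinitely many neighbors.
  obtain ⟨k, hk, hKk⟩ := (hev.and (eventually_ge_atTop K)).exists
  have htail : ∀ v ∈ S, ((E ∪ S ∩ Ici k) ∩ G.neighborSet v).Infinite := fun v hv =>
    (inter_Ici_infinite (hSinf.2 v hv) k).mono fun u hu => ⟨.inr ⟨hu.1.1, hu.2⟩, hu.1.2⟩
  refine ⟨E ∪ S ∩ Ici k, ⟨?_, ?_, ?_⟩, ?_⟩
  · exact union_subset hE.1 (inter_subset_left.trans hSinf.1)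
  · exact (inter_Ici_infinite hSi k).mono subset_union_right
  · intro v hv
    by_cases hvS : v ∈ S
    · exact .inl (htail v hvS)
    · have hvE : v ∈ E := hv.resolve_right fun h => hvS h.1
      refine .inr (eq_empty_of_forall_notMem ?_)
      rintro u ⟨hu | hu, huv⟩
      · exact hE.2 v hvE u hu huv
      · exact ((mem_Iio.1 (hk v hvE hvS ⟨hu.1, huv⟩)).not_ge hu.2).elim
  · ext u
    simp only [mem_inter_iff, mem_union, mem_Iio, mem_Ici]
    constructor
    · rintro ⟨hu | hu, hlt⟩
      · exact hu
      · omega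
    · exact fun hu => ⟨.inl hu, hEK hu⟩

/-- An infinite set of vertices of finite degree contains an infinite independent set. -/
theorem exists_isIndep_of_infinite (hY : Y ⊆ G.verts)
    (hD : {v ∈ Y | (Y ∩ G.neighborSet v).Finite}.Infinite) :
    ∃ I ⊆ Y, I.Infinite ∧ G.IsIndep I := by
  set D := {v ∈ Y | (Y ∩ G.neighborSet v).Finite}
  have : Std.Symm fun u v => u ≠ v ∧ ¬ G.Adj u v :=
    ⟨fun u v h => ⟨h.1.symm, fun h' => h.2 h'.symm⟩⟩
  -- Greedy choice: the vertices chosen so far exclude only themselves and their finitely many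
  -- neighbors.
  obtain ⟨f, hf, hr⟩ := exists_seq_of_forall_finset_exists' (fun v => v ∈ D)
    (fun u v => u ≠ v ∧ ¬ G.Adj u v) (fun s hs => by
      have hfin : ((s : Set ℕ) ∪ ⋃ v ∈ s, Y ∩ G.neighborSet v).Finite :=
        s.finite_toSet.union (s.finite_toSet.biUnion fun v hv => (hs v hv).2)
      obtain ⟨y, hyD, hy⟩ := (hD.sdiff hfin).nonempty
      simp only [mem_union, Finset.mem_coe, mem_iUnion, not_or, not_exists] at hy
      exact ⟨y, hyD, fun x hx => ⟨fun h => hy.1 (h ▸ hx), fun h => hy.2 x hx ⟨hyD.1, h⟩⟩⟩)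
  refine ⟨range f, range_subset_iff.2 fun n => (hf n).1, infinite_range_of_injective ?_,
    range_subset_iff.2 fun n => hY (hf n).1, ?_⟩
  · intro m n h
    by_contra hmn
    exact (hr hmn).1 h
  · rintro _ ⟨m, rfl⟩ _ ⟨n, rfl⟩ h
    by_cases hmn : m = n
    · exact G.loopless.irrefl _ (hmn ▸ h)
    · exact (hr hmn).2 h

/-- Removing a finite set that contains all vertices of finite degree leaves a set that has infinite
degree at all of its vertices. -/
theorem isInfDegree_diff (hY : Y ⊆ G.verts) {B : Set ℕ} (hB : B.Finite)
    (hDB : {v ∈ Y | (Y ∩ G.neighborSet v).Finite} ⊆ B) : G.IsInfDegree (Y \ B) := by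
  refine ⟨sdiff_subset.trans hY, fun v hv => ?_⟩
  have hvi : (Y ∩ G.neighborSet v).Infinite := fun h => hv.2 (hDB ⟨hv.1, h⟩)
  exact (hvi.sdiff hB).mono fun u hu => ⟨⟨hu.1.1, hu.2⟩, hu.1.2⟩

/-- If no nonempty set has infinite degree at all of its vertices, then a finite independent set
is an initial segment of a solution unless almost all vertices are adjacent to it. -/
theorem IsIndep.exists_isSolution_of_infinite (hE : G.IsIndep E) (hEK : E ⊆ Iio K)
    (hS : ∀ Z, G.IsInfDegree Z → Z = ∅)
    (hinf : {v ∈ G.verts | ∀ u ∈ E, ¬ G.Adj u v}.Infinite) :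
    ∃ H, G.IsSolution H ∧ H ∩ Iio K = E := by
  set Y := {v ∈ G.verts | ∀ u ∈ E, ¬ G.Adj u v} ∩ Ici K with hY
  have hYi : Y.Infinite := inter_Ici_infinite hinf K
  have hYV : Y ⊆ G.verts := fun v hv => hv.1.1
  -- Otherwise deleting the finitely many vertices of finite degree from `Y` would leave a nonempty
  -- set that contradicts `hS`.
  have hD : {v ∈ Y | (Y ∩ G.neighborSet v).Finite}.Infinite := by
    intro hfin
    have := hS _ (isInfDegree_diff hYV hfin Subset.rfl)
    exact (hYi.sdiff hfin).nonempty.ne_empty this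
  obtain ⟨I, hIY, hIi, hI⟩ := exists_isIndep_of_infinite hYV hD
  refine ⟨E ∪ I, IsIndep.isSolution ⟨union_subset hE.1 hI.1, ?_⟩ (hIi.mono subset_union_right), ?_⟩
  · rintro u (hu | hu) v (hv | hv)
    · exact hE.2 u hu v hv
    · exact (hIY hv).1.2 u hu
    · exact fun h => (hIY hu).1.2 v hv h.symm
    · exact hI.2 u hu v hv
  · ext u
    simp only [mem_inter_iff, mem_union, mem_Iio]
    constructor
    · rintro ⟨hu | hu, hlt⟩
      · exact hu
      · exact absurd hlt (not_lt.2 (hIY hu).2)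
    · exact fun hu => ⟨.inl hu, hEK hu⟩

/-- If there are arbitrarily late finite sets of vertices to which almost all vertices are
adjacent, then some nonempty set has infinite degree at all of its vertices. -/
theorem exists_isInfDegree (𝓔 : Set (Set ℕ)) (hfin : ∀ E ∈ 𝓔, E.Finite)
    (hne : ∀ E ∈ 𝓔, E.Nonempty) (hV : ∀ E ∈ 𝓔, E ⊆ G.verts) (hlate : ∀ k, ∃ E ∈ 𝓔, E ⊆ Ici k)
    (hadj : ∀ E ∈ 𝓔, {v ∈ G.verts | ∀ u ∈ E, ¬ G.Adj u v}.Finite) :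
    ∃ Z, Z.Nonempty ∧ G.IsInfDegree Z := by
  -- A minimal element of `P` will do. Nonempty intersections with arbitrarily late `E` keep the
  -- members of `P` infinite.
  let P : Set (Set ℕ) := {Z | Z ⊆ G.verts ∧ ∀ E ∈ 𝓔, (Z ∩ E).Nonempty ∧
    {v ∈ Z | ∀ u ∈ Z ∩ E, ¬ G.Adj u v}.Finite}
  have hVP : G.verts ∈ P := by
    refine ⟨Subset.rfl, fun E hE => ?_⟩
    rw [inter_eq_self_of_subset_right (hV E hE)]
    exact ⟨hne E hE, hadj E hE⟩
  have hPinf : ∀ Z ∈ P, Z.Infinite := by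
    intro Z hZ hZf
    obtain ⟨b, hb⟩ := hZf.bddAbove
    obtain ⟨E, hE, hEb⟩ := hlate (b + 1)
    obtain ⟨v, hvZ, hvE⟩ := (hZ.2 E hE).1
    have h1 := hb hvZ
    have h2 : b + 1 ≤ v := hEb hvE
    omega
  obtain ⟨Z, -, hZ⟩ := zorn_superset_nonempty P (fun c hcP hc hcne => by
    -- As `E` is finite, a single member of the chain already has the same trace on `E` as the whole
    -- intersection.
    have key : ∀ E ∈ 𝓔, ∃ Z ∈ c, Z ∩ E = ⋂₀ c ∩ E := by
      intro E hE
      have hch : ∀ v ∈ E, ∃ Z ∈ c, v ∈ Z → v ∈ ⋂₀ c := by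
        intro v _
        by_cases hv : v ∈ ⋂₀ c
        · obtain ⟨Z, hZ⟩ := hcne
          exact ⟨Z, hZ, fun _ => hv⟩
        · simp only [mem_sInter, not_forall] at hv
          obtain ⟨Z, hZ, hvZ⟩ := hv
          exact ⟨Z, hZ, fun h => (hvZ h).elim⟩
      choose! z hzc hz using hch
      obtain ⟨W, hWc, hW⟩ : ∃ W ∈ c, ∀ v ∈ E, W ⊆ z v := by
        have hsub : ∀ B ⊆ E, ∃ W ∈ c, ∀ v ∈ B, W ⊆ z v := fun B hBE => by
          induction B, (hfin E hE).subset hBE using Set.Finite.induction_on with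
          | empty => exact ⟨_, hcne.some_mem, fun v hv => hv.elim⟩
          | insert hv hB ih =>
            obtain ⟨W, hWc, hW⟩ := ih ((subset_insert _ _).trans hBE)
            have hvc := hzc _ (hBE (mem_insert _ _))
            rcases hc.total hWc hvc with h | h
            · exact ⟨W, hWc, forall_mem_insert.2 ⟨h, hW⟩⟩
            · exact ⟨_, hvc, forall_mem_insert.2 ⟨Subset.rfl, fun u hu => h.trans (hW u hu)⟩⟩
        exact hsub E Subset.rfl
      refine ⟨W, hWc, Subset.antisymm (fun v hv => ⟨hz v hv.2 (hW v hv.2 hv.1), hv.2⟩) ?_⟩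
      exact inter_subset_inter_left _ (sInter_subset_of_mem hWc)
    refine ⟨⋂₀ c, ⟨?_, fun E hE => ?_⟩, fun s hs => sInter_subset_of_mem hs⟩
    · obtain ⟨Z, hZ⟩ := hcne
      exact (sInter_subset_of_mem hZ).trans (hcP hZ).1
    · obtain ⟨Z, hZc, hZE⟩ := key E hE
      rw [← hZE]
      refine ⟨((hcP hZc).2 E hE).1, ((hcP hZc).2 E hE).2.subset ?_⟩
      exact fun v hv => ⟨sInter_subset_of_mem hZc hv.1, hv.2⟩) G.verts hVP
  have hZP : Z ∈ P := hZ.prop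
  refine ⟨Z, (hPinf Z hZP).nonempty, hZP.1, fun v hv hvfin => ?_⟩
  -- A vertex `v` with finitely many neighbors in `Z` can be dropped: only these neighbors may have
  -- relied on `v`. This contradicts minimality.
  have hdiff : Z \ {v} ∈ P := by
    refine ⟨sdiff_subset.trans hZP.1, fun E hE => ?_⟩
    have hfin' : {w ∈ Z \ {v} | ∀ u ∈ (Z \ {v}) ∩ E, ¬ G.Adj u w}.Finite := by
      refine (((hZP.2 E hE).2).union hvfin).subset ?_
      intro w hw
      by_cases hwv : G.Adj v w
      · exact .inr ⟨hw.1.1, hwv⟩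
      · refine .inl ⟨hw.1.1, fun u hu => ?_⟩
        by_cases huv : u = v
        · exact huv ▸ hwv
        · exact hw.2 u ⟨⟨hu.1, huv⟩, hu.2⟩
    -- If `Z \ {v}` missed `E`, all of the infinite set `Z \ {v}` would vacuously lie in the finite
    -- exceptional set.
    refine ⟨nonempty_iff_ne_empty.2 fun hemp => ?_, hfin'⟩
    refine ((hPinf Z hZP).sdiff (finite_singleton v)) (hfin'.subset fun w hw => ⟨hw, ?_⟩)
    simp [hemp]
  exact (hZ.le_of_le hdiff sdiff_subset hv).2 rfl

/-- In a graph without infinite independent sets, almost all tails of the vertex set are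
solutions. -/
theorem exists_forall_isSolution_Ici (hV : G.verts.Infinite)
    (hG : ∀ I, G.IsIndep I → I.Finite) :
    ∃ k₀, ∀ k ≥ k₀, G.IsSolution (G.verts ∩ Ici k) := by
  have hfin : {v ∈ G.verts | (G.verts ∩ G.neighborSet v).Finite}.Finite := by
    by_contra h
    obtain ⟨I, -, hIi, hI⟩ := exists_isIndep_of_infinite Subset.rfl h
    exact hIi (hG I hI)
  obtain ⟨b, hb⟩ := hfin.bddAbove
  refine ⟨b + 1, fun k hk => ?_⟩
  have heq : G.verts ∩ Ici k = G.verts \ Iio k := by ext; simp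
  have := isInfDegree_diff Subset.rfl (finite_Iio k) fun v hv => by
    have := hb hv
    simp only [mem_Iio]
    omega
  rw [heq]
  exact ⟨this.1, hV.sdiff (finite_Iio k), fun v hv => .inl (this.2 v hv)⟩

end NatGraph

/-! ### Sets of rationals of order type `ω + ω*` -/

theorem finite_of_finite_Iio_of_finite_Ioi {α : Type*} [LinearOrder α] {D : Set α} {y : α}
    (h₁ : (D ∩ Iio y).Finite) (h₂ : (D ∩ Ioi y).Finite) : D.Finite :=
  ((h₁.union h₂).union (finite_singleton y)).subset fun z hz => by
    rcases lt_trichotomy z y with h | h | h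
    · exact .inl (.inl ⟨hz, h⟩)
    · exact .inr h
    · exact .inl (.inr ⟨hz, h⟩)

/-- The set of rational numbers has order type `ω + ω*`. -/
def IsOmegaAddOmegaStar (X : Set ℚ) : Prop :=
  (∀ x ∈ X, (X ∩ Iio x).Finite ∨ (X ∩ Ioi x).Finite) ∧
    {x ∈ X | (X ∩ Iio x).Finite}.Infinite ∧ {x ∈ X | (X ∩ Ioi x).Finite}.Infinite

/-- An infinite linear order in which every element has finitely many predecessors is isomorphic
to `ℕ`. -/
theorem nonempty_orderIso_nat {α : Type*} [LinearOrder α] [Infinite α]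
    (h : ∀ x : α, (Iio x).Finite) : Nonempty (α ≃o ℕ) := by
  classical
  -- The rank embeds the order in `ℕ`, and every infinite subset of `ℕ` is isomorphic to `ℕ`.
  let f : α → ℕ := fun x => (Iio x).ncard
  have hf : StrictMono f := fun x y hxy =>
    ncard_lt_ncard (ssubset_iff_of_subset (Iio_subset_Iio hxy.le) |>.2 ⟨x, hxy, lt_irrefl x⟩) (h y)
  have : Infinite (range f) := (infinite_range_of_injective hf.injective).to_subtype
  exact ⟨(hf.orderIso f).trans (Nat.Subtype.orderIsoOfNat (range f)).symm⟩

theorem IsOmegaAddOmegaStar.nonempty_relIso {X : Set ℚ} (hX : IsOmegaAddOmegaStar X) :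
    Nonempty (((· < ·) : X → X → Prop) ≃r ((· < ·) : ℕ ⊕ₗ ℕᵒᵈ → ℕ ⊕ₗ ℕᵒᵈ → Prop)) := by
  classical
  obtain ⟨hdich, hlow, hhigh⟩ := hX
  set A := {x ∈ X | (X ∩ Iio x).Finite} with hA
  set B := {x ∈ X | (X ∩ Ioi x).Finite} with hB
  have hdisj : ∀ x, x ∈ A → x ∈ B → False := fun x h1 h2 =>
    hlow ((finite_of_finite_Iio_of_finite_Ioi h1.2 h2.2).subset fun y hy => hy.1)
  have hAB : ∀ x ∈ A, ∀ y ∈ B, x < y := by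
    intro x hx y hy
    by_contra hle
    exact hdisj y ⟨hy.1, hx.2.subset
      (inter_subset_inter_right _ (Iio_subset_Iio (not_lt.1 hle)))⟩ hy
  have : Infinite A := hlow.to_subtype
  have : Infinite B := hhigh.to_subtype
  have : Infinite Bᵒᵈ := Infinite.of_injective OrderDual.toDual OrderDual.toDual.injective
  obtain ⟨e⟩ := nonempty_orderIso_nat (α := A) fun x => by
    refine Finite.of_finite_image (f := Subtype.val) (x.2.2.subset ?_) Subtype.val_injective.injOn
    rintro _ ⟨y, hy, rfl⟩
    exact ⟨y.2.1, hy⟩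
  obtain ⟨e'⟩ := nonempty_orderIso_nat (α := Bᵒᵈ) fun x => by
    refine Finite.of_finite_image (f := fun y : Bᵒᵈ => ((OrderDual.ofDual y : B) : ℚ))
      ((OrderDual.ofDual x).2.2.subset ?_) (Subtype.val_injective.comp OrderDual.ofDual.injective).injOn
    rintro _ ⟨y, hy, rfl⟩
    exact ⟨(OrderDual.ofDual y).2.1, hy⟩
  have hnA : ∀ x : X, (x : ℚ) ∉ A → (x : ℚ) ∈ B := fun x hx =>
    ⟨x.2, (hdich x x.2).resolve_left fun h => hx ⟨x.2, h⟩⟩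
  let f : X → ℕ ⊕ₗ ℕᵒᵈ := fun x => if h : (x : ℚ) ∈ A then Sum.inlₗ (e ⟨x, h⟩)
    else Sum.inrₗ (OrderDual.toDual (e' (OrderDual.toDual ⟨x, hnA x h⟩)))
  have hfA : ∀ (x : X) (h : (x : ℚ) ∈ A), f x = Sum.inlₗ (e ⟨x, h⟩) := fun x h => dif_pos h
  have hfB : ∀ (x : X) (h : (x : ℚ) ∈ B),
      f x = Sum.inrₗ (OrderDual.toDual (e' (OrderDual.toDual ⟨x, h⟩))) := fun x h =>
    dif_neg fun h' => hdisj _ h' h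
  have hmono : StrictMono f := by
    intro x y hxy
    by_cases hx : (x : ℚ) ∈ A <;> by_cases hy : (y : ℚ) ∈ A
    · rw [hfA x hx, hfA y hy, Sum.Lex.inl_lt_inl_iff]
      exact e.strictMono hxy
    · rw [hfA x hx, hfB y (hnA y hy)]
      exact Sum.Lex.inl_lt_inr _ _
    · exact absurd hxy (hAB y hy x (hnA x hx)).asymm
    · rw [hfB x (hnA x hx), hfB y (hnA y hy), Sum.Lex.inr_lt_inr_iff]
      exact e'.strictMono (show OrderDual.toDual (⟨y, hnA y hy⟩ : B) <
        OrderDual.toDual (⟨x, hnA x hx⟩ : B) from hxy)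
  have hsurj : Function.Surjective f := by
    intro z
    rcases z with n | n
    · refine ⟨⟨e.symm n, (e.symm n).2.1⟩, ?_⟩
      rw [hfA _ (e.symm n).2]
      simp [Sum.inlₗ]
      rfl
    · let b : B := OrderDual.ofDual (e'.symm (OrderDual.ofDual n))
      refine ⟨⟨b, b.2.1⟩, ?_⟩
      rw [hfB _ b.2]
      simp [Sum.inrₗ, b]
      rfl
  exact ⟨(hmono.orderIsoOfSurjective f hsurj).toRelIsoLT⟩

/-! ### Forcing with finite conditions and a free interval for the cut -/

/-- An enumeration of the rational numbers. -/
def index : ℚ ≃ ℕ := Denumerable.eqv ℚ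

theorem finite_index_lt (N : ℕ) : {x | index x < N}.Finite :=
  (finite_Iio N).preimage index.injective.injOn

/-- Finite information about a set of rational numbers: its elements of index less than `N`, and
an interval that contains all its other elements. -/
structure Cond where
  /-- The elements of index less than `N`. -/
  F : Set ℚ
  /-- The bound below which membership is decided. -/
  N : ℕ
  /-- The lower end of the interval. -/
  a : ℚ
  /-- The upper end of the interval. -/
  b : ℚ
  /-- The interval is not empty. -/
  a_lt_b : a < b
  /-- The indices of the decided elements are bounded. -/
  index_lt : ∀ x ∈ F, index x < N

namespace Cond

/-- The set `X` has the properties that `p` specifies. -/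
def Sat (p : Cond) (X : Set ℚ) : Prop :=
  (∀ x, index x < p.N → (x ∈ X ↔ x ∈ p.F)) ∧ ∀ x ∈ X, p.N ≤ index x → x ∈ Ioo p.a p.b

/-- The condition `q` refines `p`. -/
def Refines (q p : Cond) : Prop :=
  p.N ≤ q.N ∧ p.Sat q.F ∧ Ioo q.a q.b ⊆ Ioo p.a p.b

theorem finite_F (p : Cond) : p.F.Finite :=
  (finite_index_lt p.N).subset p.index_lt

theorem sat_F (p : Cond) : p.Sat p.F :=
  ⟨fun _ _ => Iff.rfl, fun x hx h => absurd (p.index_lt x hx) (not_lt.2 h)⟩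

theorem Refines.refl (p : Cond) : p.Refines p := ⟨le_rfl, p.sat_F, Subset.rfl⟩

theorem Refines.sat {q p : Cond} (h : q.Refines p) {X : Set ℚ} (hX : q.Sat X) : p.Sat X := by
  refine ⟨fun x hx => (hX.1 x (hx.trans_le h.1)).trans (h.2.1.1 x hx), fun x hx hN => ?_⟩
  by_cases hxq : index x < q.N
  · exact h.2.1.2 x ((hX.1 x hxq).1 hx) hN
  · exact h.2.2 (hX.2 x hx (not_lt.1 hxq))

theorem Refines.trans {r q p : Cond} (h : r.Refines q) (h' : q.Refines p) : r.Refines p :=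
  ⟨h'.1.trans h.1, h'.sat h.2.1, h.2.2.trans h'.2.2⟩

/-- The condition that decides `X` up to a bound and puts all other elements between `a` and
`b`. -/
def restrict (X : Set ℚ) (N : ℕ) (a b : ℚ) (h : a < b) : Cond where
  F := X ∩ {x | index x < N}
  N := N
  a := a
  b := b
  a_lt_b := h
  index_lt _ hx := hx.2

theorem restrict_refines {p : Cond} {X : Set ℚ} (hX : p.Sat X) {N : ℕ} (hN : p.N ≤ N) {a b : ℚ}
    (h : a < b) (hab : Ioo a b ⊆ Ioo p.a p.b) : (restrict X N a b h).Refines p := by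
  refine ⟨hN, ⟨fun x hx => ?_, fun x hx => hX.2 x hx.1⟩, hab⟩
  rw [← hX.1 x hx]
  exact ⟨fun h => h.1, fun h => ⟨h, hx.trans_le hN⟩⟩

/-- The condition `q` puts all elements decided by `p` outside of its interval, and new ones on
either side of it. -/
structure Separates (q p : Cond) : Prop where
  refines : q.Refines p
  notMem : ∀ x ∈ p.F, x ∉ Ioo q.a q.b
  exists_le : ∃ u ∈ q.F, p.N ≤ index u ∧ u ≤ q.a
  exists_ge : ∃ u ∈ q.F, p.N ≤ index u ∧ q.b ≤ u

theorem exists_index_ge {a b : ℚ} (h : a < b) (N : ℕ) : ∃ x ∈ Ioo a b, N ≤ index x := by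
  obtain ⟨x, hx, hN⟩ := ((Ioo_infinite h).sdiff (finite_index_lt N)).nonempty
  exact ⟨x, hx, not_lt.1 hN⟩

theorem exists_separates (p : Cond) : ∃ q : Cond, q.Separates p := by
  obtain ⟨c, hc⟩ := exists_between p.a_lt_b
  obtain ⟨u, hu, huN⟩ := exists_index_ge hc.1 p.N
  obtain ⟨v, hv, hvN⟩ := exists_index_ge hc.2 p.N
  have huv : u < v := hu.2.trans hv.1
  -- The new interval is a neighborhood of `d` between `u` and `v` that avoids the finite set `p.F`.
  obtain ⟨d, hd, hdF⟩ := ((Ioo_infinite huv).sdiff p.finite_F).nonempty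
  have hnhds : Ioo u v ∩ p.Fᶜ ∈ nhds d :=
    inter_mem (Ioo_mem_nhds hd.1 hd.2) (p.finite_F.isClosed.isOpen_compl.mem_nhds hdF)
  obtain ⟨a, b, hdab, hsub⟩ := mem_nhds_iff_exists_Ioo_subset.1 hnhds
  have hab : a < b := hdab.1.trans hdab.2
  have hle := (Ioo_subset_Ioo_iff hab).1 (hsub.trans inter_subset_left)
  have hX : p.Sat (p.F ∪ {u, v}) := by
    constructor
    · intro x hx
      refine ⟨?_, .inl⟩
      rintro (h | rfl | rfl)
      · exact h
      · omega
      · omega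
    · rintro x (h | rfl | rfl) hN
      · exact absurd (p.index_lt x h) (not_lt.2 hN)
      · exact ⟨hu.1, hu.2.trans hc.2⟩
      · exact ⟨hc.1.trans hv.1, hv.2⟩
  refine ⟨restrict (p.F ∪ {u, v}) (max (index u) (index v) + 1) a b hab,
    restrict_refines hX (by omega) hab ?_, fun x hx hx' => (hsub hx').2 hx, ?_, ?_⟩
  · exact Ioo_subset_Ioo (hu.1.le.trans hle.1) (hle.2.trans hv.2.le)
  · exact ⟨u, ⟨.inr (.inl rfl), by simp only [mem_ofPred_eq]; omega⟩, huN, hle.1⟩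
  · exact ⟨v, ⟨.inr (.inr rfl), by simp only [mem_ofPred_eq]; omega⟩, hvN, hle.2⟩

/-- Undecided elements of `X` lie to the right of `p.a`, so whatever lies further left has index
below `p.N`. -/
theorem Sat.finite_Iio {p : Cond} {X : Set ℚ} (hX : p.Sat X) {x : ℚ} (hx : x ≤ p.a) :
    (X ∩ Iio x).Finite := by
  refine (finite_index_lt p.N).subset fun y hy => ?_
  by_contra h
  exact lt_irrefl _ ((hX.2 y hy.1 (not_lt.1 h)).1.trans (hy.2.trans_le hx))

theorem Sat.finite_Ioi {p : Cond} {X : Set ℚ} (hX : p.Sat X) {x : ℚ} (hx : p.b ≤ x) :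
    (X ∩ Ioi x).Finite := by
  refine (finite_index_lt p.N).subset fun y hy => ?_
  by_contra h
  exact lt_irrefl _ ((hX.2 y hy.1 (not_lt.1 h)).2.trans (hx.trans_lt hy.2))

/-- The union of a sequence of conditions, each of which separates its predecessor, has order type
`ω + ω*` and satisfies all of them. -/
theorem isOmegaAddOmegaStar_iUnion {p : ℕ → Cond} (hp : ∀ n, (p (n + 1)).Separates (p n)) :
    IsOmegaAddOmegaStar (⋃ n, (p n).F) ∧ ∀ n, (p n).Sat (⋃ n, (p n).F) := by
  have href : ∀ m n, m ≤ n → (p n).Refines (p m) := fun m n h => by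
    induction n, h using Nat.le_induction with
    | base => exact .refl _
    | succ n _ ih => exact (hp n).refines.trans ih
  have hsat : ∀ n, (p n).Sat (⋃ n, (p n).F) := by
    refine fun n => ⟨fun x hx => ⟨fun h => ?_, fun h => mem_iUnion.2 ⟨n, h⟩⟩, fun x hx hN => ?_⟩
    · obtain ⟨m, hm⟩ := mem_iUnion.1 h
      rcases le_total m n with hmn | hmn
      · exact ((href m n hmn).2.1.1 x ((p m).index_lt x hm)).2 hm
      · exact ((href n m hmn).2.1.1 x hx).1 hm
    · obtain ⟨m, hm⟩ := mem_iUnion.1 hx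
      rcases le_total m n with hmn | hmn
      · exact absurd (((p m).index_lt x hm).trans_le (href m n hmn).1) (not_lt.2 hN)
      · exact (href n m hmn).2.1.2 x hm hN
  have hN : ∀ n, n ≤ (p n).N := by
    intro n
    induction n with
    | zero => exact Nat.zero_le _
    | succ n ih =>
      obtain ⟨u, hu, hle, -⟩ := (hp n).exists_le
      have := (p (n + 1)).index_lt u hu
      omega
  have hinf : ∀ A : Set ℚ, (∀ n, ∃ u ∈ A, (p n).N ≤ index u) → A.Infinite := by
    intro A hA hfin
    obtain ⟨b, hb⟩ := (hfin.image index).bddAbove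
    obtain ⟨u, hu, hle⟩ := hA (b + 1)
    have := hb (mem_image_of_mem _ hu)
    have := hN (b + 1)
    omega
  refine ⟨⟨fun x hx => ?_, hinf _ fun n => ?_, hinf _ fun n => ?_⟩, hsat⟩
  · obtain ⟨n, hn⟩ := mem_iUnion.1 hx
    have := (hp n).notMem x hn
    rw [mem_Ioo, not_and_or, not_lt, not_lt] at this
    exact this.imp (hsat (n + 1)).finite_Iio (hsat (n + 1)).finite_Ioi
  · obtain ⟨u, hu, hle, hua⟩ := (hp n).exists_le
    exact ⟨u, ⟨mem_iUnion.2 ⟨_, hu⟩, (hsat (n + 1)).finite_Iio hua⟩, hle⟩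
  · obtain ⟨u, hu, hle, hua⟩ := (hp n).exists_ge
    exact ⟨u, ⟨mem_iUnion.2 ⟨_, hu⟩, (hsat (n + 1)).finite_Ioi hua⟩, hle⟩

/-- Countably many dense requirements can be met below any condition. -/
theorem exists_generic (p₀ : Cond) (D : ℕ → Cond → Prop)
    (hD : ∀ k q, q.Refines p₀ → ∃ r : Cond, r.Refines q ∧ D k r) :
    ∃ X, IsOmegaAddOmegaStar X ∧ p₀.Sat X ∧ ∀ k, ∃ r : Cond, D k r ∧ r.Sat X := by
  -- Each step meets one requirement and then separates, which makes the union have type `ω + ω*`.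
  have hstep : ∀ (k : ℕ) (q : {q : Cond // q.Refines p₀}), ∃ s : {q : Cond // q.Refines p₀},
      s.1.Separates q.1 ∧ ∃ r : Cond, D k r ∧ s.1.Refines r := by
    rintro k ⟨q, hq⟩
    obtain ⟨r, hr, hDr⟩ := hD k q hq
    obtain ⟨s, hs⟩ := r.exists_separates
    refine ⟨⟨s, hs.refines.trans (hr.trans hq)⟩, ⟨hs.refines.trans hr, ?_, ?_, ?_⟩, r, hDr, hs.refines⟩
    · intro x hx
      exact hs.notMem x ((hr.2.1.1 x (q.index_lt x hx)).2 hx)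
    · obtain ⟨u, hu, hle, h⟩ := hs.exists_le
      exact ⟨u, hu, hr.1.trans hle, h⟩
    · obtain ⟨u, hu, hle, h⟩ := hs.exists_ge
      exact ⟨u, hu, hr.1.trans hle, h⟩
  choose next hsep hnext using hstep
  let s : ℕ → {q : Cond // q.Refines p₀} := fun n =>
    Nat.rec ⟨p₀, .refl p₀⟩ (fun k q => next k q) n
  obtain ⟨hX, hsat⟩ := isOmegaAddOmegaStar_iUnion (p := fun n => (s n).1) fun n => hsep n (s n)
  refine ⟨_, hX, hsat 0, fun k => ?_⟩
  obtain ⟨r, hDr, hr⟩ := hnext k (s k)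
  exact ⟨r, hDr, hr.sat (hsat (k + 1))⟩

end Cond

/-! ### Diagonalization against continuous reductions -/

/-- A continuous map `G` from the sets of rational numbers of order type `ω + ω*` to infinite
graphs, with a continuous map `C` that sends the solutions for `G X` to infinite chains in `X`. -/
structure IsContinuousReduction (G : Set ℚ → NatGraph) (C : Set ℚ → Set ℕ → Set ℚ) : Prop where
  infinite_verts : ∀ X, IsOmegaAddOmegaStar X → (G X).verts.Infinite
  graph_continuous : ∀ X, IsOmegaAddOmegaStar X → ∀ n, ∃ K, ∀ X', IsOmegaAddOmegaStar X' →
    (∀ x, index x < K → (x ∈ X' ↔ x ∈ X)) →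
      (∀ u < n, u ∈ (G X').verts ↔ u ∈ (G X).verts) ∧
        ∀ u < n, ∀ v < n, (G X').Adj u v ↔ (G X).Adj u v
  subset : ∀ X, IsOmegaAddOmegaStar X → ∀ H, (G X).IsSolution H → C X H ⊆ X
  infinite : ∀ X, IsOmegaAddOmegaStar X → ∀ H, (G X).IsSolution H → (C X H).Infinite
  chain : ∀ X, IsOmegaAddOmegaStar X → ∀ H, (G X).IsSolution H →
    (∀ y ∈ C X H, (C X H ∩ Iio y).Finite) ∨ ∀ y ∈ C X H, (C X H ∩ Ioi y).Finite
  chain_continuous : ∀ X, IsOmegaAddOmegaStar X → ∀ H, (G X).IsSolution H → ∀ y ∈ C X H,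
    ∃ K, ∀ X', IsOmegaAddOmegaStar X' → (∀ x, index x < K → (x ∈ X' ↔ x ∈ X)) →
      ∀ H', (G X').IsSolution H' → (∀ u < K, u ∈ H' ↔ u ∈ H) → y ∈ C X' H'

namespace IsContinuousReduction

variable {G : Set ℚ → NatGraph} {C : Set ℚ → Set ℕ → Set ℚ}

/-- The chain found from a solution contains elements that are still free to be put on either side
of the cut; doing so makes it impossible to extend an initial segment of the solution. -/
theorem exists_refines (h : IsContinuousReduction G C) {q : Cond} {X : Set ℚ}
    (hX : IsOmegaAddOmegaStar X) (hq : q.Sat X) {H : Set ℕ} (hH : (G X).IsSolution H) (k : ℕ) :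
    ∃ r : Cond, r.Refines q ∧ ∃ K ≥ k, ∀ X', IsOmegaAddOmegaStar X' → r.Sat X' →
      (∀ u < K, u ∈ (G X').verts ↔ u ∈ (G X).verts) ∧
        (∀ u < K, ∀ v < K, (G X').Adj u v ↔ (G X).Adj u v) ∧
          ∀ H', (G X').IsSolution H' → H' ∩ Iio K ≠ H ∩ Iio K := by
  have hC := (h.infinite X hX H hH).sdiff (finite_index_lt q.N)
  obtain ⟨y, hy, z, hz, hyz⟩ : ∃ y ∈ C X H \ {x | index x < q.N},
      ∃ z ∈ C X H \ {x | index x < q.N}, y < z := by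
    obtain ⟨y, hy, z, hz, hne⟩ := hC.nontrivial
    rcases hne.lt_or_gt with hlt | hlt
    · exact ⟨y, hy, z, hz, hlt⟩
    · exact ⟨z, hz, y, hy, hlt⟩
  have hmem : ∀ x ∈ C X H \ {x | index x < q.N}, x ∈ Ioo q.a q.b := fun x hx =>
    hq.2 x (h.subset X hX H hH hx.1) (not_lt.1 hx.2)
  obtain ⟨K₁, hK₁⟩ := h.chain_continuous X hX H hH y hy.1
  obtain ⟨K₂, hK₂⟩ := h.chain_continuous X hX H hH z hz.1
  set K := max k (max K₁ K₂) with hK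
  obtain ⟨M, hM⟩ := h.graph_continuous X hX K
  -- Agreement of `X'` with `X` up to `N` fixes the graph below `K` and covers the uses for
  -- enumerating `y` and `z`.
  set N := max q.N (max M K) with hN
  refine ⟨Cond.restrict X N y z hyz, Cond.restrict_refines hq (by omega) hyz
    (Ioo_subset_Ioo (hmem y hy).1.le (hmem z hz).2.le), K, by omega, fun X' hX' hs => ?_⟩
  have hagree : ∀ x, index x < N → (x ∈ X' ↔ x ∈ X) := fun x hx =>
    (hs.1 x hx).trans ⟨fun h => h.1, fun h => ⟨h, hx⟩⟩
  obtain ⟨hV, hA⟩ := hM X' hX' fun x hx => hagree x (by omega)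
  refine ⟨hV, hA, fun H' hH' heq => ?_⟩
  have hHH : ∀ u < K, u ∈ H' ↔ u ∈ H := fun u hu => by
    have := Set.ext_iff.1 heq u
    simpa [hu] using this
  have hy' := hK₁ X' hX' (fun x hx => hagree x (by omega)) H' hH' fun u hu => hHH u (by omega)
  have hz' := hK₂ X' hX' (fun x hx => hagree x (by omega)) H' hH' fun u hu => hHH u (by omega)
  have hsub := h.subset X' hX' H' hH'
  refine h.infinite X' hX' H' hH' ?_
  -- An ascending chain through `z` is finite because `X'` has finitely many elements above `z`;
  -- dually for a descending chain and `y`.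
  rcases h.chain X' hX' H' hH' with hc | hc
  · exact finite_of_finite_Iio_of_finite_Ioi (hc z hz')
      ((hs.finite_Ioi le_rfl).subset (inter_subset_inter_left _ hsub))
  · exact finite_of_finite_Iio_of_finite_Ioi
      ((hs.finite_Iio le_rfl).subset (inter_subset_inter_left _ hsub)) (hc y hy')

theorem not_forall_exists_isIndep (h : IsContinuousReduction G C) :
    ¬ ∀ q : Cond, ∃ X, IsOmegaAddOmegaStar X ∧ q.Sat X ∧ ∃ I, I.Infinite ∧ (G X).IsIndep I := by
  intro hind
  obtain ⟨X, hX, -, hgen⟩ := Cond.exists_generic ⟨∅, 0, 0, 1, zero_lt_one, by simp⟩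
    (fun k r => ∃ E : Set ℕ, E.Nonempty ∧ E ⊆ Ici k ∧ ∃ K, E ⊆ Iio K ∧
      ∀ X, IsOmegaAddOmegaStar X → r.Sat X → (G X).IsIndep E ∧
        ∀ H, (G X).IsSolution H → H ∩ Iio K ≠ E) (fun k q _ => by
    obtain ⟨X, hX, hq, I, hIi, hI⟩ := hind q
    have hH := NatGraph.inter_Ici_infinite hIi k
    obtain ⟨v, hv⟩ := hH.nonempty
    have hHi := hI.mono (inter_subset_left (t := Ici k))
    -- The bound `v + 1` keeps `v` below `K`, so the forbidden initial segment is nonempty.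
    obtain ⟨r, hr, K, hKv, hK⟩ := h.exists_refines hX hq (hHi.isSolution hH) (v + 1)
    refine ⟨r, hr, I ∩ Ici k ∩ Iio K, ⟨v, hv, hKv⟩, fun u hu => hu.1.2, K, inter_subset_right,
      fun X' hX' hs => ?_⟩
    obtain ⟨hV, hA, hno⟩ := hK X' hX' hs
    exact ⟨⟨fun u hu => (hV u hu.2).2 (hHi.1 hu.1), fun u hu v hv hadj =>
      hHi.2 u hu.1 v hv.1 ((hA u hu.2 v hv.2).1 hadj)⟩, hno⟩)
  let 𝓔 : Set (Set ℕ) := {E | E.Nonempty ∧ ∃ K, E ⊆ Iio K ∧ (G X).IsIndep E ∧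
    ∀ H, (G X).IsSolution H → H ∩ Iio K ≠ E}
  have hlate : ∀ k, ∃ E ∈ 𝓔, E ⊆ Ici k := by
    intro k
    obtain ⟨r, ⟨E, hne, hEk, K, hEK, hE⟩, hr⟩ := hgen k
    exact ⟨E, ⟨hne, K, hEK, hE X hX hr⟩, hEk⟩
  have hS : ∀ Z, (G X).IsInfDegree Z → Z = ∅ := by
    intro Z hZ
    by_contra hne
    obtain ⟨E, ⟨-, K, hEK, hE, hno⟩, -⟩ := hlate 0
    obtain ⟨H, hH, hHE⟩ :=
      hE.exists_isSolution_of_isInfDegree hEK hZ (nonempty_iff_ne_empty.2 hne)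
    exact hno H hH hHE
  obtain ⟨Z, hne, hZ⟩ := NatGraph.exists_isInfDegree (G := G X) 𝓔
    (fun E hE => let ⟨_, K, hK, _⟩ := hE; (finite_Iio K).subset hK) (fun E hE => hE.1)
    (fun E hE => let ⟨_, _, _, hi, _⟩ := hE; hi.1) hlate fun E hE => by
      obtain ⟨-, K, hEK, hE, hno⟩ := hE
      by_contra hinf
      obtain ⟨H, hH, hHE⟩ := hE.exists_isSolution_of_infinite hEK hS hinf
      exact hno H hH hHE
  exact hne.ne_empty (hS Z hZ)

/-- Otherwise late tails of the vertex set are solutions for every `X` below `p`, whereas a generic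
`X` forbids initial segments of arbitrarily late tails. -/
theorem exists_isIndep (h : IsContinuousReduction G C) (p : Cond) :
    ∃ X, IsOmegaAddOmegaStar X ∧ p.Sat X ∧ ∃ I, I.Infinite ∧ (G X).IsIndep I := by
  by_contra hcon
  have htail : ∀ X, IsOmegaAddOmegaStar X → p.Sat X →
      ∃ k₀, ∀ k ≥ k₀, (G X).IsSolution ((G X).verts ∩ Ici k) := fun X hX hp =>
    NatGraph.exists_forall_isSolution_Ici (h.infinite_verts X hX) fun I hI => by
      by_contra hinf
      exact hcon ⟨X, hX, hp, I, hinf, hI⟩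
  obtain ⟨X, hX, hp, hgen⟩ := Cond.exists_generic p
    (fun k r => ∃ l ≥ k, ∃ K, ∀ X, IsOmegaAddOmegaStar X → r.Sat X →
      ∀ H, (G X).IsSolution H → H ∩ Iio K ≠ (G X).verts ∩ Ici l ∩ Iio K) (fun k q hqp => by
    -- Trivial requirements: only some `X` of the right type that satisfies `q` is needed.
    obtain ⟨X, hX, hq, -⟩ := Cond.exists_generic q (fun _ _ => True) fun _ r _ =>
      ⟨r, .refl r, trivial⟩
    obtain ⟨k₀, hk₀⟩ := htail X hX (hqp.sat hq)
    obtain ⟨r, hr, K, -, hK⟩ := h.exists_refines hX hq (hk₀ (max k k₀) (le_max_right _ _)) 0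
    refine ⟨r, hr, max k k₀, le_max_left _ _, K, fun X' hX' hs H hH => ?_⟩
    obtain ⟨hV, -, hno⟩ := hK X' hX' hs
    have heq : (G X').verts ∩ Ici (max k k₀) ∩ Iio K = (G X).verts ∩ Ici (max k k₀) ∩ Iio K := by
      ext u
      exact and_congr_left fun hu => and_congr_left fun _ => hV u hu
    exact heq ▸ hno H hH)
  obtain ⟨k₀, hk₀⟩ := htail X hX hp
  obtain ⟨r, ⟨l, hl, K, hK⟩, hr⟩ := hgen k₀
  exact hK X hX hr _ (hk₀ l hl) rfl

end IsContinuousReduction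

theorem not_isContinuousReduction (G : Set ℚ → NatGraph) (C : Set ℚ → Set ℕ → Set ℚ) :
    ¬ IsContinuousReduction G C :=
  fun h => h.not_forall_exists_isIndep h.exists_isIndep

/-! ### From Weihrauch reductions to continuous reductions via codes -/

theorem charFn_eq_iff {A B : Set ℕ} {n : ℕ} : charFn A n = charFn B n ↔ (n ∈ A ↔ n ∈ B) := by
  classical
  by_cases hA : n ∈ A <;> by_cases hB : n ∈ B <;> simp [charFn, hA, hB]

theorem join_two_mul (f g : ℕ → ℕ) (n : ℕ) : join f g (2 * n) = f n := by
  simp [join]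

theorem join_two_mul_add_one (f g : ℕ → ℕ) (n : ℕ) : join f g (2 * n + 1) = g n := by
  have h : (2 * n + 1) / 2 = n := by omega
  simp [join, h, Nat.add_mod]

theorem join_congr {f f' g g' : ℕ → ℕ} {K : ℕ} (hf : ∀ i < K, f i = f' i)
    (hg : ∀ i < K, g i = g' i) : ∀ i < K, join f g i = join f' g' i := by
  intro i hi
  simp only [join]
  split_ifs
  · exact hf _ (by omega)
  · exact hg _ (by omega)

/-- The order on the indices of a set of rational numbers. -/
def ratOrd (X : Set ℚ) : LinOrd where
  carrier := {n | index.symm n ∈ X}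
  lt x y := index.symm x < index.symm y
  isStrictTotalOrder :=
    { trichotomous := fun _ _ h₁ h₂ => Subtype.ext (index.symm.injective
        (le_antisymm (not_lt.1 h₂) (not_lt.1 h₁)))
      irrefl := fun _ => lt_irrefl _
      trans := fun _ _ _ => lt_trans }

theorem IsOmegaAddOmegaStar.hasType {X : Set ℚ} (hX : IsOmegaAddOmegaStar X) :
    (ratOrd X).HasTypeOmegaAddOmegaStar := by
  obtain ⟨e⟩ := hX.nonempty_relIso
  exact ⟨RelIso.trans ⟨index.symm.subtypeEquiv fun _ => Iff.rfl, Iff.rfl⟩ e⟩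

theorem code_ratOrd_congr {X X' : Set ℚ} {K : ℕ} (h : ∀ x, index x < K → (x ∈ X' ↔ x ∈ X)) :
    ∀ i < K, (ratOrd X').code i = (ratOrd X).code i := by
  have hmem : ∀ n < K, (n ∈ (ratOrd X').carrier ↔ n ∈ (ratOrd X).carrier) := fun n hn =>
    h (index.symm n) (by simpa using hn)
  refine join_congr (fun i hi => charFn_eq_iff.2 (hmem i hi)) fun i hi => charFn_eq_iff.2 ?_
  have hle : ∀ x y, i = Nat.pair x y → x < K ∧ y < K := fun x y hxy =>
    ⟨(hxy ▸ Nat.left_le_pair x y).trans_lt hi, (hxy ▸ Nat.right_le_pair x y).trans_lt hi⟩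
  constructor
  · rintro ⟨x, y, hlt, rfl⟩
    obtain ⟨hx, hy⟩ := hle _ _ rfl
    exact ⟨⟨x, (hmem x hx).1 x.2⟩, ⟨y, (hmem y hy).1 y.2⟩, hlt, rfl⟩
  · rintro ⟨x, y, hlt, rfl⟩
    obtain ⟨hx, hy⟩ := hle _ _ rfl
    exact ⟨⟨x, (hmem x hx).2 x.2⟩, ⟨y, (hmem y hy).2 y.2⟩, hlt, rfl⟩

theorem LinOrd.mem_pairs_iff (L : LinOrd) (x y : L.carrier) :
    Nat.pair x y ∈ {n | ∃ x y : L.carrier, L.lt x y ∧ n = Nat.pair (x : ℕ) (y : ℕ)} ↔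
      L.lt x y := by
  constructor
  · rintro ⟨x', y', hlt, heq⟩
    obtain ⟨hx, hy⟩ := Nat.pair_eq_pair.1 heq
    rwa [Subtype.ext hx, Subtype.ext hy]
  · exact fun h => ⟨x, y, h, rfl⟩

/-- A code determines its order, so the order witnessing the solution is that of `X`, transported
along `index`. -/
theorem mem_SADC_sol {X : Set ℚ} {k : ℕ → ℕ} (hk : k ∈ SADC.sol (ratOrd X).code) :
    ∃ D ⊆ X, D.Infinite ∧ ((∀ y ∈ D, (D ∩ Iio y).Finite) ∨ ∀ y ∈ D, (D ∩ Ioi y).Finite) ∧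
      k = charFn (index '' D) := by
  obtain ⟨L, hL, C, hC, hchain, rfl⟩ := hk
  have hcar : ∀ n, index.symm n ∈ X ↔ n ∈ L.carrier := fun n => by
    have := congrFun hL (2 * n)
    simp only [LinOrd.code, join_two_mul] at this
    exact charFn_eq_iff.1 this
  have hlt : ∀ x y : L.carrier, index.symm x < index.symm y ↔ L.lt x y := fun x y => by
    have := congrFun hL (2 * Nat.pair x y + 1)
    simp only [LinOrd.code, join_two_mul_add_one] at this
    rw [charFn_eq_iff, L.mem_pairs_iff x y] at this
    rw [← this]
    exact ((ratOrd X).mem_pairs_iff ⟨x, (hcar x).2 x.2⟩ ⟨y, (hcar y).2 y.2⟩).symm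
  let f : L.carrier → ℚ := fun x => index.symm x
  have hf : Function.Injective f := index.symm.injective.comp Subtype.val_injective
  refine ⟨f '' C, ?_, hC.image hf.injOn, hchain.imp ?_ ?_, ?_⟩
  · rintro _ ⟨x, -, rfl⟩
    exact (hcar x).2 x.2
  · rintro h _ ⟨y, hy, rfl⟩
    refine ((h y hy).image f).subset ?_
    rintro _ ⟨⟨x, hx, rfl⟩, hxy⟩
    exact ⟨x, ⟨hx, (hlt x y).1 hxy⟩, rfl⟩
  · rintro h _ ⟨y, hy, rfl⟩
    refine ((h y hy).image f).subset ?_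
    rintro _ ⟨⟨x, hx, rfl⟩, hxy⟩
    exact ⟨x, ⟨hx, (hlt y x).1 hxy⟩, rfl⟩
  · rw [image_image]
    simp [f]

theorem NatGraph.mem_pairs_iff (G : NatGraph) {u v : ℕ} (huv : u < v) :
    Nat.pair u v ∈ {n | ∃ x y : ℕ, x < y ∧ G.Adj x y ∧ n = Nat.pair x y} ↔ G.Adj u v := by
  constructor
  · rintro ⟨x, y, -, hadj, heq⟩
    obtain ⟨rfl, rfl⟩ := Nat.pair_eq_pair.1 heq
    exact hadj
  · exact fun h => ⟨u, v, huv, h, rfl⟩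

theorem NatGraph.congr_of_code {G G' : NatGraph} {n : ℕ}
    (h : ∀ i < 2 * n ^ 2, NatGraph.code G' i = NatGraph.code G i) :
    (∀ u < n, u ∈ G'.verts ↔ u ∈ G.verts) ∧ ∀ u < n, ∀ v < n, G'.Adj u v ↔ G.Adj u v := by
  have hlt : ∀ u < n, ∀ v < n, u < v → (G'.Adj u v ↔ G.Adj u v) := by
    intro u hu v hv huv
    -- Edges below `n` have codes below `n ^ 2`, hence sit at odd positions below `2 * n ^ 2`.
    have hp : Nat.pair u v < n ^ 2 := (Nat.pair_lt_max_add_one_sq u v).trans_le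
      (Nat.pow_le_pow_left (by omega) 2)
    have := h (2 * Nat.pair u v + 1) (by omega)
    simp only [NatGraph.code, join_two_mul_add_one] at this
    rwa [charFn_eq_iff, mem_pairs_iff _ huv, mem_pairs_iff _ huv] at this
  refine ⟨fun u hu => ?_, fun u hu v hv => ?_⟩
  · have := h (2 * u) (by nlinarith)
    simp only [NatGraph.code, join_two_mul] at this
    exact charFn_eq_iff.1 this
  · rcases lt_trichotomy u v with huv | rfl | huv
    · exact hlt u hu v hv huv
    · exact iff_of_false (G'.loopless.irrefl u) (G.loopless.irrefl u)
    · rw [G'.adj_comm, G.adj_comm]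
      exact hlt v hv u hu huv

theorem exists_isContinuousReduction (h : WeihrauchReducible SADC wRSgr) :
    ∃ G C, IsContinuousReduction G C := by
  obtain ⟨_, _, ⟨c, rfl⟩, ⟨d, rfl⟩, hred⟩ := h
  have hG : ∀ X, ∃ G : NatGraph, IsOmegaAddOmegaStar X → G.verts.Infinite ∧
      NatGraph.code G ∈ c.functional (ratOrd X).code ∧ ∀ H, G.IsSolution H →
        ∃ D ⊆ X, D.Infinite ∧ ((∀ y ∈ D, (D ∩ Iio y).Finite) ∨ ∀ y ∈ D, (D ∩ Ioi y).Finite) ∧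
          charFn (index '' D) ∈ d.functional (join (ratOrd X).code (charFn H)) := by
    intro X
    by_cases hX : IsOmegaAddOmegaStar X
    · obtain ⟨_, hh, ⟨G, hV, rfl⟩, hsol⟩ := hred _ ⟨ratOrd X, hX.hasType, rfl⟩
      refine ⟨G, fun _ => ⟨hV, hh, fun H hH => ?_⟩⟩
      obtain ⟨k, hk, hks⟩ := hsol (charFn H) ⟨G, rfl, H, hH.1, hH.2.1, hH.2.2, rfl⟩
      obtain ⟨D, hDX, hD, hchain, rfl⟩ := mem_SADC_sol hks
      exact ⟨D, hDX, hD, hchain, hk⟩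
    -- A dummy graph makes `G` total.
    · exact ⟨⊥, fun h => (hX h).elim⟩
  choose G hV hcode hsol using hG
  choose! C hsub hinf hchain hmem using hsol
  refine ⟨G, C, hV, fun X hX n => ?_, hsub, hinf, hchain, fun X hX H hH y hy => ?_⟩
  · obtain ⟨K, hK⟩ := OracleCode.exists_use (hcode X hX) (2 * n ^ 2)
    exact ⟨K, fun X' hX' hXX' =>
      NatGraph.congr_of_code (hK _ (code_ratOrd_congr hXX') _ (hcode X' hX'))⟩
  · obtain ⟨K, hK⟩ := OracleCode.exists_use (hmem X hX H hH) (index y + 1)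
    refine ⟨K, fun X' hX' hXX' H' hH' hHH' => ?_⟩
    have := hK _ (join_congr (code_ratOrd_congr hXX') fun i hi => charFn_eq_iff.2 (hHH' i hi)) _
      (hmem X' hX' H' hH') (index y) (Nat.lt_succ_self _)
    rw [charFn_eq_iff] at this
    simpa using this.2 (mem_image_of_mem _ hy)

end RivalSands

theorem mainTheorem6 :
    ¬ RivalSands.WeihrauchReducible RivalSands.SADC RivalSands.wRSgr := by
  intro h
  obtain ⟨G, C, hGC⟩ := RivalSands.exists_isContinuousReduction h
  exact RivalSands.not_isContinuousReduction G C hGC
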